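/- Let $(\Omega,\mathcal F,\mathbb P)$ be a complete nonatomic probability space and let $\rho\in L^2$ satisfy $\mathbb P(\rho>0)=1$ and $\mathrm{Var}[\rho]>0$. For random variables $X,Y$ write $X\succeq_{\mathrm{icx}}Y$ if $\mathrm E[f(X)]\ge \mathrm E[f(Y)]$ for every increasing convex function $f:\mathbb R\to\mathbb R$ for which both expectations exist. Let $X_0\in L^\infty$ and $x\in\mathbb R$. Let $Q_0(t)=\inf\{y\in\mathbb R : \mathbb P(X_0\le y)>t\}$ for $t\in[0,1)$ be the upper quantile function of $X_0$, and put $Q_0(1)=\lim_{t\uparrow 1}Q_0(t)$. Define $$\mathscr X(x)=\{X\in L^2 : \mathrm E[\rho X]\le x\},$$ $$\mathscr X_{\mathrm{icx}}(x,X_0+z)=\{X\in L^2 : \mathrm E[\rho X]\le x\ \text{and}\ X\succeq_{\mathrm{icx}}X_0+z\}\qquad(z\in\mathbb R),$$ $$\psi(X)=\sup\{m\in\mathbb R : X-m\succeq_{\mathrm{icx}}X_0\}\in[-\infty,\infty],\qquad \sup\emptyset=-\infty.$$ A payoff $X\in\mathscr X(x)$ is called beating-performance-variance (BPV) efficient in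 $\mathscr X(x)$ if there is no $Y\in\mathscr X(x)$ with $\psi(Y)\ge\psi(X)$ and $\mathrm{Var}[Y]\le\mathrm{Var}[X]$ and at least one of these two inequalities strict. A payoff $X$ is called variance-minimal in $\mathscr X_{\mathrm{icx}}(x,X_0+z)$ if it belongs to this set and $\mathrm{Var}[X]\le\mathrm{Var}[Y]$ for every $Y$ in it. Then $X^*$ is BPV efficient in $\mathscr X(x)$ if and only if there is a real number $z\ge \dfrac{x}{\mathrm E[\rho]}-Q_0(1)$ such that $X^*$ is variance-minimal in $\mathscr X_{\mathrm{icx}}(x,X_0+z)$. -/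

import Mathlib

open MeasureTheory ProbabilityTheory

noncomputable section

namespace BPV

variable {Ω : Type*} [MeasurableSpace Ω]

/-- A measure is nonatomic if every measurable set of positive measure contains a measurable
subset of strictly smaller positive measure. -/
def Nonatomic (μ : Measure Ω) : Prop :=
  ∀ A : Set Ω, MeasurableSet A → 0 < μ A →
    ∃ B : Set Ω, B ⊆ A ∧ MeasurableSet B ∧ 0 < μ B ∧ μ B < μ A

/-- The infimum `inf {x ∈ ℝ | P(X ≤ x) > t}` that defines the upper quantile for `t ∈ [0,1)`. -/
def quantileInf (μ : Measure Ω) (X : Ω → ℝ) (t : ℝ) : ℝ :=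
  sInf {x : ℝ | t < μ.real {ω | X ω ≤ x}}

/-- The upper quantile function `Q_X`, extended to `t = 1` by the left limit `Q_X(1-)`. -/
def upperQuantile (μ : Measure Ω) (X : Ω → ℝ) (t : ℝ) : ℝ :=
  if t < 1 then quantileInf μ X t else Function.leftLim (quantileInf μ X) 1

/-- `IcxGE μ X Y` means that `X` dominates `Y` in the increasing convex order:
`E[f(X)] ≥ E[f(Y)]` for all increasing convex `f` for which both expectations exist. -/
def IcxGE (μ : Measure Ω) (X Y : Ω → ℝ) : Prop :=
  ∀ f : ℝ → ℝ, Monotone f → ConvexOn ℝ Set.univ f →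
    Integrable (fun ω => f (X ω)) μ → Integrable (fun ω => f (Y ω)) μ →
    ∫ ω, f (Y ω) ∂μ ≤ ∫ ω, f (X ω) ∂μ

/-- The square integrable payoffs `X` with `E[ρX] ≤ x`. -/
def budgetSet (μ : Measure Ω) (ρ : Ω → ℝ) (x : ℝ) : Set (Ω → ℝ) :=
  {X | MemLp X 2 μ ∧ ∫ ω, ρ ω * X ω ∂μ ≤ x}

/-- The square integrable payoffs `X` with `E[ρX] ≤ x` that dominate `X₀` in the
increasing convex order. -/
def icxSet (μ : Measure Ω) (ρ : Ω → ℝ) (x : ℝ) (X₀ : Ω → ℝ) : Set (Ω → ℝ) :=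
  {X | MemLp X 2 μ ∧ ∫ ω, ρ ω * X ω ∂μ ≤ x ∧ IcxGE μ X X₀}

/-- `X` has minimal variance among the members of the set `S` of payoffs. -/
def IsVarianceMinimal (μ : Measure Ω) (S : Set (Ω → ℝ)) (X : Ω → ℝ) : Prop :=
  X ∈ S ∧ ∀ Y ∈ S, variance X μ ≤ variance Y μ

/-- The performance of `X` of beating `X₀`: the supremum, in the extended reals, of all real `m`
such that `X - m` dominates `X₀` (so that the supremum over the empty set is `-∞`). -/
def beatingPerformance (μ : Measure Ω) (X₀ X : Ω → ℝ) : EReal :=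
  sSup ((fun m : ℝ => (m : EReal)) '' {m : ℝ | IcxGE μ (fun ω => X ω - m) X₀})

/-- `X` is beating-performance-variance efficient in the set `S` of payoffs. -/
def IsBPVEfficient (μ : Measure Ω) (X₀ : Ω → ℝ) (S : Set (Ω → ℝ)) (X : Ω → ℝ) : Prop :=
  X ∈ S ∧ ¬ ∃ Y ∈ S,
    (beatingPerformance μ X₀ X ≤ beatingPerformance μ X₀ Y ∧ variance Y μ ≤ variance X μ) ∧
    (beatingPerformance μ X₀ X < beatingPerformance μ X₀ Y ∨ variance Y μ < variance X μ)

end BPV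

end

open MeasureTheory ProbabilityTheory Filter Topology

namespace BPV

variable {Ω : Type*} [MeasurableSpace Ω] {μ : Measure Ω}

/-! Since X₀ is bounded, the supremum ψ(X) is attained: ψ(X) ≥ z iff X dominates X₀ + z
(`le_beatingPerformance_iff`). The benchmark is the riskless payoff c = x/E[ρ], with zero variance
and performance at least c - Q₀(1). An efficient X therefore has ψ(X) ≥ c - Q₀(1). Comparing means
gives ψ(X) < ∞, and X is variance-minimal for z = ψ(X). Conversely, let X be variance-minimal for z
and let Y beat it. If ψ(Y) ≥ z and Var[Y] < Var[X], minimality fails at once. If ψ(Y) > z and Var[Y]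
> 0, moving Y slightly towards c spends the surplus performance to lower the variance strictly
(`exists_variance_lt`). If Var[Y] = 0, then ψ(Y) ≤ c - Q₀(1) ≤ z (`le_of_variance_eq_zero`), a
contradiction; this is where the bound on z enters. -/

theorem exists_ae_bound {X : Ω → ℝ} (hX : MemLp X ⊤ μ) :
    ∃ B : ℝ, 0 ≤ B ∧ ∀ᵐ ω ∂μ, |X ω| ≤ B := by
  refine ⟨(eLpNorm X ⊤ μ).toReal, ENNReal.toReal_nonneg, ?_⟩
  rw [eLpNorm_exponent_top]
  filter_upwards [ae_le_eLpNormEssSup (f := X) (μ := μ)] with ω hω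
  have h : eLpNormEssSup X μ ≠ ⊤ := by
    have := hX.eLpNorm_ne_top
    rwa [eLpNorm_exponent_top] at this
  have := ENNReal.toReal_mono h hω
  simpa using this

theorem continuous_of_convexOn {f : ℝ → ℝ} (hf : ConvexOn ℝ Set.univ f) : Continuous f :=
  continuousOn_univ.1 (hf.continuousOn isOpen_univ)

theorem convexOn_comp_affine {f : ℝ → ℝ} (hf : ConvexOn ℝ Set.univ f) (a c : ℝ) :
    ConvexOn ℝ Set.univ (fun y => f (a * y + c)) := by
  refine ⟨convex_univ, fun y _ w _ s t hs ht hst => ?_⟩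
  have h := hf.2 (Set.mem_univ (a * y + c)) (Set.mem_univ (a * w + c)) hs ht hst
  have e : a * (s • y + t • w) + c = s • (a * y + c) + t • (a * w + c) := by
    simp only [smul_eq_mul]
    linear_combination (-c) * hst
  change f (a * (s • y + t • w) + c) ≤ _
  rw [e]
  exact h

/-- The increasing convex order is preserved by increasing affine maps. -/
theorem IcxGE.affine {X Y : Ω → ℝ} (h : IcxGE μ X Y) {a : ℝ} (ha : 0 ≤ a) (c : ℝ) :
    IcxGE μ (fun ω => a * X ω + c) (fun ω => a * Y ω + c) := by
  intro f hm hc h1 h2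
  exact h (fun y => f (a * y + c)) (fun y w hyw => hm (by gcongr)) (convexOn_comp_affine hc a c)
    h1 h2

theorem icxGE_of_ae_le {X Y : Ω → ℝ} (h : Y ≤ᵐ[μ] X) : IcxGE μ X Y := by
  intro f hm _ h1 h2
  refine integral_mono_ae h2 h1 ?_
  filter_upwards [h] with ω hω
  exact hm hω

theorem icxGE_sub_iff {X Y : Ω → ℝ} {m : ℝ} :
    IcxGE μ (fun ω => X ω - m) Y ↔ IcxGE μ X (fun ω => Y ω + m) := by
  constructor
  · intro h
    simpa using h.affine zero_le_one m
  · intro h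
    simpa [sub_eq_add_neg] using h.affine zero_le_one (-m)

theorem exists_of_lt_beatingPerformance {X₀ X : Ω → ℝ} {z : ℝ}
    (h : (z : EReal) < beatingPerformance μ X₀ X) :
    ∃ m : ℝ, z < m ∧ IcxGE μ X (fun ω => X₀ ω + m) := by
  obtain ⟨_, ⟨m, hm, rfl⟩, hlt⟩ := lt_sSup_iff.1 h
  exact ⟨m, EReal.coe_lt_coe_iff.1 hlt, icxGE_sub_iff.1 hm⟩

theorem IcxGE.integral_le {X Y : Ω → ℝ} (h : IcxGE μ X Y) (hX : Integrable X μ)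
    (hY : Integrable Y μ) : ∫ ω, Y ω ∂μ ≤ ∫ ω, X ω ∂μ :=
  h id monotone_id (convexOn_id convex_univ) hX hY

variable [IsProbabilityMeasure μ]

theorem measure_eq_one_of_ae {p : Ω → Prop} (h : ∀ᵐ ω ∂μ, p ω) : μ {ω | p ω} = 1 :=
  (measure_congr (eventuallyEq_univ.2 h)).trans measure_univ

theorem integrable_comp {X : Ω → ℝ} (hX : MemLp X ⊤ μ) {f : ℝ → ℝ} (hf : Continuous f) :
    Integrable (fun ω => f (X ω)) μ := by
  obtain ⟨B, -, hB⟩ := exists_ae_bound hX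
  obtain ⟨C, hC⟩ := (isCompact_Icc (a := -B) (b := B)).exists_bound_of_continuousOn hf.continuousOn
  refine Integrable.of_bound (hf.comp_aestronglyMeasurable hX.aestronglyMeasurable) C ?_
  filter_upwards [hB] with ω hω
  exact hC _ (abs_le.1 hω)

theorem memLp_top_affine {X : Ω → ℝ} (hX : MemLp X ⊤ μ) (a c : ℝ) :
    MemLp (fun ω => a * X ω + c) ⊤ μ :=
  (hX.const_mul a).add (memLp_const c)

theorem memLp_top_add_const {X : Ω → ℝ} (hX : MemLp X ⊤ μ) (c : ℝ) :
    MemLp (fun ω => X ω + c) ⊤ μ :=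
  hX.add (memLp_const c)

/-- A bounded dominated payoff may be replaced by a smaller one. -/
theorem IcxGE.mono_right {X Y Z : Ω → ℝ} (h : IcxGE μ X Y) (hY : MemLp Y ⊤ μ)
    (hZ : Z ≤ᵐ[μ] Y) : IcxGE μ X Z := by
  intro f hm hc h1 h2
  -- Domination says nothing for f unless f(Y) is integrable; boundedness of Y supplies this.
  have hY' := integrable_comp hY (continuous_of_convexOn hc)
  refine le_trans (integral_mono_ae h2 hY' ?_) (h f hm hc h1 hY')
  filter_upwards [hZ] with ω hω
  exact hm hω

/-- The increasing convex order is closed under decreasing shifts of the dominating payoff. -/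
theorem icxGE_of_forall_shift {X Y : Ω → ℝ} (hY : MemLp Y ⊤ μ)
    (h : ∀ ε : ℝ, 0 < ε → IcxGE μ X (fun ω => Y ω - ε)) : IcxGE μ X Y := by
  intro f hm hc h1 h2
  have hf := continuous_of_convexOn hc
  have hu : Tendsto (fun n : ℕ => 1 / ((n : ℝ) + 1)) atTop (𝓝 0) :=
    tendsto_one_div_add_atTop_nhds_zero_nat
  have hpos : ∀ n : ℕ, (0 : ℝ) < 1 / ((n : ℝ) + 1) := fun n => by positivity
  have hint : ∀ c : ℝ, Integrable (fun ω => f (Y ω - c)) μ := fun c =>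
    integrable_comp hY (hf.comp (continuous_sub_right c))
  have hlim : Tendsto (fun n : ℕ => ∫ ω, f (Y ω - 1 / ((n : ℝ) + 1)) ∂μ) atTop
      (𝓝 (∫ ω, f (Y ω) ∂μ)) := by
    -- By monotonicity f(Y - ε) lies between f(Y - 1) and f(Y) for 0 < ε ≤ 1.
    refine tendsto_integral_of_dominated_convergence
      (fun ω => |f (Y ω - 1)| + |f (Y ω)|) (fun n => (hint _).aestronglyMeasurable)
      ((hint 1).abs.add h2.abs) (fun n => ae_of_all _ fun ω => ?_) (ae_of_all _ fun ω => ?_)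
    · have h3 : 1 / ((n : ℝ) + 1) ≤ 1 := by
        rw [div_le_one (by positivity)]
        linarith [n.cast_nonneg (α := ℝ)]
      have h4 : f (Y ω - 1) ≤ f (Y ω - 1 / ((n : ℝ) + 1)) := hm (by linarith)
      have h5 : f (Y ω - 1 / ((n : ℝ) + 1)) ≤ f (Y ω) := hm (by linarith [hpos n])
      rw [Real.norm_eq_abs, abs_le]
      constructor
      · linarith [neg_abs_le (f (Y ω - 1)), abs_nonneg (f (Y ω))]
      · linarith [le_abs_self (f (Y ω)), abs_nonneg (f (Y ω - 1))]
    · have := (hf.tendsto (Y ω - 0)).comp (hu.const_sub (Y ω))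
      simpa [Function.comp_def] using this
  exact le_of_tendsto hlim (Eventually.of_forall fun n => h _ (hpos n) f hm hc h1 (hint _))

/-- The supremum defining the beating performance is attained. -/
theorem le_beatingPerformance_iff {X₀ X : Ω → ℝ} (hX₀ : MemLp X₀ ⊤ μ) {z : ℝ} :
    (z : EReal) ≤ beatingPerformance μ X₀ X ↔ IcxGE μ X (fun ω => X₀ ω + z) := by
  constructor
  · intro h
    refine icxGE_of_forall_shift (memLp_top_add_const hX₀ z) fun ε hε => ?_
    have h1 : ((z - ε : ℝ) : EReal) < beatingPerformance μ X₀ X :=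
      lt_of_lt_of_le (EReal.coe_lt_coe_iff.2 (by linarith)) h
    obtain ⟨m, hlt, hm⟩ := exists_of_lt_beatingPerformance h1
    refine hm.mono_right (memLp_top_add_const hX₀ m) (ae_of_all _ fun ω => ?_)
    change X₀ ω + z - ε ≤ X₀ ω + m
    linarith
  · intro h
    exact le_sSup ⟨z, icxGE_sub_iff.2 h, rfl⟩

/-- The identity as test function gives m ≤ E[X] - E[X₀]. -/
theorem beatingPerformance_lt_top {X₀ X : Ω → ℝ} (hX₀ : Integrable X₀ μ) (hX : Integrable X μ) :
    beatingPerformance μ X₀ X < ⊤ := by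
  refine lt_of_le_of_lt (b := ((∫ ω, X ω ∂μ - ∫ ω, X₀ ω ∂μ : ℝ) : EReal)) ?_ (EReal.coe_lt_top _)
  refine sSup_le ?_
  rintro _ ⟨m, hm, rfl⟩
  have h := IcxGE.integral_le (icxGE_sub_iff.1 hm) hX (hX₀.add (integrable_const m))
  rw [integral_add hX₀ (integrable_const m)] at h
  simp only [integral_const, probReal_univ, smul_eq_mul, one_mul] at h
  exact EReal.coe_le_coe_iff.2 (by linarith)

/-- A payoff dominated by a constant is bounded above by it. -/
theorem ae_le_of_const_icxGE {Y : Ω → ℝ} (hY : MemLp Y ⊤ μ) {c : ℝ}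
    (h : IcxGE μ (fun _ => c) Y) : ∀ᵐ ω ∂μ, Y ω ≤ c := by
  -- The test function (y - c)⁺ vanishes at c, so E[(Y - c)⁺] = 0.
  have hcont : Continuous fun y : ℝ => max (y - c) 0 := by fun_prop
  have hint := integrable_comp hY hcont
  have hconv : ConvexOn ℝ Set.univ fun y : ℝ => max (y - c) 0 :=
    ((convexOn_id convex_univ).sub (concaveOn_const c convex_univ)).sup
      (convexOn_const 0 convex_univ)
  have h1 := h (fun y => max (y - c) 0) (fun y w hyw => by dsimp only; gcongr) hconv
    (integrable_const _) hint
  simp only [sub_self, max_self, integral_zero] at h1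
  have h2 : ∫ ω, max (Y ω - c) 0 ∂μ = 0 :=
    le_antisymm h1 (integral_nonneg fun ω => le_max_right _ _)
  have h3 := (integral_eq_zero_iff_of_nonneg (fun ω => le_max_right _ _) hint).1 h2
  filter_upwards [h3] with ω hω
  have : max (Y ω - c) 0 = 0 := hω
  linarith [le_max_left (Y ω - c) 0]

/-- Q₀(1) is the essential supremum: below it the distribution function is less than 1, so quantiles
at levels near 1 exceed any smaller number. -/
theorem isLeast_upperQuantile_one {X₀ : Ω → ℝ} (hX₀ : MemLp X₀ ⊤ μ) :
    IsLeast {c : ℝ | ∀ᵐ ω ∂μ, X₀ ω ≤ c} (upperQuantile μ X₀ 1) := by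
  obtain ⟨B, -, hB⟩ := exists_ae_bound hX₀
  have hbdd : IsBoundedUnder (· ≤ ·) (ae μ) X₀ :=
    ⟨B, eventually_map.2 (hB.mono fun ω h => (abs_le.1 h).2)⟩
  have hcobdd : IsCoboundedUnder (· ≤ ·) (ae μ) X₀ :=
    IsBoundedUnder.isCoboundedUnder_le
      ⟨-B, eventually_map.2 (hB.mono fun ω h => (abs_le.1 h).1)⟩
  have hle : ∀ᵐ ω ∂μ, X₀ ω ≤ essSup X₀ μ := ae_le_essSup hbdd
  have hleast : ∀ c : ℝ, (∀ᵐ ω ∂μ, X₀ ω ≤ c) → essSup X₀ μ ≤ c := fun c hc =>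
    essSup_le_of_ae_le c hc hcobdd
  suffices h : upperQuantile μ X₀ 1 = essSup X₀ μ by
    rw [h]
    exact ⟨hle, hleast⟩
  have hone : ∀ c : ℝ, (∀ᵐ ω ∂μ, X₀ ω ≤ c) → μ.real {ω | X₀ ω ≤ c} = 1 := by
    intro c hc
    rw [measureReal_def, measure_eq_one_of_ae hc, ENNReal.toReal_one]
  -- Bounds the quantile sets below, as `csInf_le` requires.
  have hlow : ∀ t : ℝ, 0 ≤ t → ∀ y : ℝ, t < μ.real {ω | X₀ ω ≤ y} → -B ≤ y := by
    intro t ht y hy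
    by_contra hcon
    have h0 : μ {ω | X₀ ω ≤ y} = 0 := by
      refine measure_mono_null (t := {ω | ¬ |X₀ ω| ≤ B}) (fun ω hω habs => ?_) hB
      have h1 : X₀ ω ≤ y := hω
      linarith [(abs_le.1 habs).1]
    rw [measureReal_def, h0] at hy
    simp at hy
    linarith
  rw [upperQuantile, if_neg (lt_irrefl 1)]
  have hq : ∀ t : ℝ, t < 1 → (essSup X₀ μ) ∈ {y : ℝ | t < μ.real {ω | X₀ ω ≤ y}} := by
    intro t ht
    exact ht.trans_eq (hone _ hle).symm
  refine leftLim_eq_of_tendsto ?_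
  rw [tendsto_order]
  constructor
  · intro y hy
    obtain ⟨w, hyw, hw⟩ := exists_between hy
    have hlt : μ.real {ω | X₀ ω ≤ w} < 1 := by
      refine lt_of_le_of_ne measureReal_le_one fun heq => ?_
      have h1 : μ {ω | X₀ ω ≤ w} = 1 := by
        rw [measureReal_def] at heq
        rw [← ENNReal.ofReal_toReal (measure_ne_top μ {ω | X₀ ω ≤ w}), heq]
        simp
      have hns : NullMeasurableSet {ω | X₀ ω ≤ w} μ :=
        nullMeasurableSet_le hX₀.aestronglyMeasurable.aemeasurable aemeasurable_const
      have h2 : ∀ᵐ ω ∂μ, X₀ ω ≤ w := (mem_ae_iff_prob_eq_one₀ hns).2 h1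
      linarith [hleast w h2]
    filter_upwards [Ioo_mem_nhdsLT hlt] with t ht
    refine lt_of_lt_of_le hyw (le_csInf ⟨_, hq t ht.2⟩ fun v hv => ?_)
    by_contra hvw
    have h1 : μ.real {ω | X₀ ω ≤ v} ≤ μ.real {ω | X₀ ω ≤ w} :=
      measureReal_mono fun ω (hω : X₀ ω ≤ v) => hω.trans (not_le.1 hvw).le
    have h2 : t < μ.real {ω | X₀ ω ≤ v} := hv
    linarith [ht.1]
  · intro y hy
    filter_upwards [Ioo_mem_nhdsLT (zero_lt_one (α := ℝ))] with t ht
    exact lt_of_le_of_lt (csInf_le ⟨-B, fun v hv => hlow t ht.1.le v hv⟩ (hq t ht.2)) hy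

/-! ### The riskless payoff and mixtures with it -/

theorem const_icxGE {X₀ : Ω → ℝ} (hX₀ : MemLp X₀ ⊤ μ) (c : ℝ) :
    IcxGE μ (fun _ => c) (fun ω => X₀ ω + (c - upperQuantile μ X₀ 1)) := by
  refine icxGE_of_ae_le ?_
  filter_upwards [(isLeast_upperQuantile_one hX₀).1] with ω hω
  linarith

theorem const_mem_budgetSet {ρ : Ω → ℝ} {p : ℝ} (hp : 0 < ∫ ω, ρ ω ∂μ) :
    (fun _ => p / ∫ ω, ρ ω ∂μ) ∈ budgetSet μ ρ p := by
  refine ⟨memLp_const _, ?_⟩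
  rw [integral_mul_const, mul_div_cancel₀ _ hp.ne']

/-- Mixing with the riskless payoff of maximal price preserves the budget constraint. -/
theorem mix_mem_budgetSet {ρ Y : Ω → ℝ} (hρ : MemLp ρ 2 μ) (hp : 0 < ∫ ω, ρ ω ∂μ) {x : ℝ}
    (hY : Y ∈ budgetSet μ ρ x) {l : ℝ} (hl : l ≤ 1) :
    (fun ω => (1 - l) * Y ω + l * (x / ∫ ω, ρ ω ∂μ)) ∈ budgetSet μ ρ x := by
  refine ⟨(hY.1.const_mul (1 - l)).add (memLp_const _), ?_⟩
  have h1 : Integrable (fun ω => ρ ω * Y ω) μ := hρ.integrable_mul hY.1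
  have h2 : Integrable ρ μ := hρ.integrable (by norm_num)
  have e : (fun ω => ρ ω * ((1 - l) * Y ω + l * (x / ∫ ω, ρ ω ∂μ)))
      = fun ω => (1 - l) * (ρ ω * Y ω) + (ρ ω) * (l * (x / ∫ ω, ρ ω ∂μ)) := by
    ext ω
    ring
  rw [e, integral_add (h1.const_mul _) (h2.mul_const _), integral_const_mul, integral_mul_const]
  have h3 : (∫ ω, ρ ω ∂μ) * (l * (x / ∫ ω, ρ ω ∂μ)) = l * x := by
    field_simp
  rw [h3]
  nlinarith [hY.2]

/-- A payoff of positive variance whose beating performance exceeds `z` does not have minimal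
variance. -/
theorem exists_variance_lt {ρ X₀ Y : Ω → ℝ} (hρ : MemLp ρ 2 μ) (hp : 0 < ∫ ω, ρ ω ∂μ)
    (hX₀ : MemLp X₀ ⊤ μ) {x z m : ℝ} (hY : Y ∈ budgetSet μ ρ x) (hzm : z < m)
    (hicx : IcxGE μ Y (fun ω => X₀ ω + m)) (hvar : 0 < variance Y μ) :
    ∃ W ∈ icxSet μ ρ x (fun ω => X₀ ω + z), variance W μ < variance Y μ := by
  obtain ⟨B, hB0, hB⟩ := exists_ae_bound hX₀
  set c := x / ∫ ω, ρ ω ∂μ with hc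
  -- K bounds X₀ + m - c, so weight l on c costs at most l * K = m - z of performance; the last
  -- summand of K ensures l ≤ 1.
  set K := B + |m| + |c| + (m - z) with hK
  have hKpos : 0 < K := by positivity [abs_nonneg m, abs_nonneg c, sub_pos.2 hzm]
  set l := (m - z) / K with hl
  have hl0 : 0 < l := div_pos (sub_pos.2 hzm) hKpos
  have hl1 : l ≤ 1 := by
    rw [hl, div_le_one hKpos]
    linarith [abs_nonneg m, abs_nonneg c]
  have hlK : l * K = m - z := div_mul_cancel₀ _ hKpos.ne'
  have hmem := mix_mem_budgetSet hρ hp hY hl1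
  refine ⟨_, ⟨hmem.1, hmem.2, ?_⟩, ?_⟩
  · refine (hicx.affine (sub_nonneg.2 hl1) (l * c)).mono_right
      (memLp_top_affine (memLp_top_add_const hX₀ m) _ _) ?_
    filter_upwards [hB] with ω hω
    have h1 : X₀ ω + m - c ≤ K := by
      linarith [(abs_le.1 hω).2, le_abs_self m, neg_abs_le c]
    have h2 := mul_le_mul_of_nonneg_left h1 hl0.le
    change X₀ ω + z ≤ (1 - l) * (X₀ ω + m) + l * c
    linarith
  · have e : variance (fun ω => (1 - l) * Y ω + l * c) μ = (1 - l) ^ 2 * variance Y μ := by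
      rw [variance_add_const (hY.1.aestronglyMeasurable.const_mul _), variance_const_mul]
    rw [e]
    have : (1 - l) ^ 2 < 1 := by nlinarith
    nlinarith

/-- The beating performance of a payoff of zero variance is at most that of the riskless
payoff of maximal price. -/
theorem le_of_variance_eq_zero {ρ X₀ Y : Ω → ℝ} (hp : 0 < ∫ ω, ρ ω ∂μ)
    (hX₀ : MemLp X₀ ⊤ μ) {x m : ℝ} (hY : Y ∈ budgetSet μ ρ x)
    (hicx : IcxGE μ Y (fun ω => X₀ ω + m)) (hvar : variance Y μ = 0) :
    m ≤ x / (∫ ω, ρ ω ∂μ) - upperQuantile μ X₀ 1 := by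
  have hae : ∀ᵐ ω ∂μ, Y ω = ∫ ω, Y ω ∂μ := by
    refine ae_eq_integral_of_variance_eq_zero hY.1 hvar
  set c := ∫ ω, Y ω ∂μ with hc
  have h1 : IcxGE μ (fun _ => c) (fun ω => X₀ ω + m) := by
    intro f hm hcv _ h2
    have e : (fun ω => f (Y ω)) =ᵐ[μ] fun _ => f c := hae.mono fun ω h => by simp only [h]
    rw [← integral_congr_ae e]
    exact hicx f hm hcv ((integrable_const _).congr e.symm) h2
  have h2 := ae_le_of_const_icxGE (memLp_top_add_const hX₀ m) h1
  have h3 : upperQuantile μ X₀ 1 ≤ c - m :=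
    (isLeast_upperQuantile_one hX₀).2 (h2.mono fun ω h => by linarith)
  have h4 : c ≤ x / ∫ ω, ρ ω ∂μ := by
    rw [le_div_iff₀ hp]
    have e : (fun ω => ρ ω * Y ω) =ᵐ[μ] fun ω => ρ ω * c := hae.mono fun ω h => by
      simp only [h]
    have := hY.2
    rw [integral_congr_ae e, integral_mul_const] at this
    linarith
  linarith

end BPV

theorem mainTheorem3 {Ω : Type*} [MeasurableSpace Ω]
    (μ : MeasureTheory.Measure Ω) [MeasureTheory.IsProbabilityMeasure μ] [μ.IsComplete]
    (hμ : BPV.Nonatomic μ)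
    (ρ : Ω → ℝ) (hρ : MeasureTheory.MemLp ρ 2 μ) (hρ_pos : ∀ᵐ ω ∂μ, 0 < ρ ω)
    (hρ_var : 0 < ProbabilityTheory.variance ρ μ)
    (X₀ : Ω → ℝ) (hX₀ : MeasureTheory.MemLp X₀ ⊤ μ)
    (x : ℝ) (X : Ω → ℝ) :
    BPV.IsBPVEfficient μ X₀ (BPV.budgetSet μ ρ x) X ↔
      ∃ z : ℝ, x / (∫ ω, ρ ω ∂μ) - BPV.upperQuantile μ X₀ 1 ≤ z ∧
        BPV.IsVarianceMinimal μ (BPV.icxSet μ ρ x (fun ω => X₀ ω + z)) X := by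
  have hp : 0 < ∫ ω, ρ ω ∂μ := by
    rw [integral_pos_iff_support_of_nonneg_ae (hρ_pos.mono fun ω h => h.le)
      (hρ.integrable (by norm_num))]
    have h1 : μ (Function.support ρ) = 1 :=
      BPV.measure_eq_one_of_ae (hρ_pos.mono fun ω h => h.ne')
    rw [h1]
    exact one_pos
  constructor
  · rintro ⟨hX, heff⟩
    have hz₀ : ((x / (∫ ω, ρ ω ∂μ) - BPV.upperQuantile μ X₀ 1 : ℝ) : EReal)
        ≤ BPV.beatingPerformance μ X₀ X := by
      by_contra hlt
      have hconst := (BPV.le_beatingPerformance_iff hX₀).2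
        (BPV.const_icxGE hX₀ (x / ∫ ω, ρ ω ∂μ))
      have hlt' := (not_le.1 hlt).trans_le hconst
      refine heff ⟨_, BPV.const_mem_budgetSet hp, ⟨hlt'.le, ?_⟩, Or.inl hlt'⟩
      rw [variance_eq_integral aemeasurable_const]
      simp [variance_nonneg X μ]
    have htop := BPV.beatingPerformance_lt_top (hX₀.integrable le_top)
      (hX.1.integrable (by norm_num))
    obtain ⟨z, hz⟩ : ∃ z : ℝ, (z : EReal) = BPV.beatingPerformance μ X₀ X :=
      ⟨_, EReal.coe_toReal htop.ne (ne_bot_of_le_ne_bot (EReal.coe_ne_bot _) hz₀)⟩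
    refine ⟨z, EReal.coe_le_coe_iff.1 (hz₀.trans hz.ge),
      ⟨hX.1, hX.2, (BPV.le_beatingPerformance_iff hX₀).1 hz.le⟩, fun Y hY => ?_⟩
    by_contra hlt
    have hlt' := not_le.1 hlt
    exact heff ⟨Y, ⟨hY.1, hY.2.1⟩,
      ⟨hz ▸ (BPV.le_beatingPerformance_iff hX₀).2 hY.2.2, hlt'.le⟩, Or.inr hlt'⟩
  · rintro ⟨z, hz, hX, hmin⟩
    refine ⟨⟨hX.1, hX.2.1⟩, ?_⟩
    rintro ⟨Y, hY, ⟨hperf, hvar⟩, hstrict⟩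
    have hzX := (BPV.le_beatingPerformance_iff hX₀).2 hX.2.2
    rcases hstrict with h | h
    · obtain ⟨m, hzm, hm⟩ := BPV.exists_of_lt_beatingPerformance (hzX.trans_lt h)
      rcases (variance_nonneg Y μ).eq_or_lt with h0 | h0
      · linarith [BPV.le_of_variance_eq_zero hp hX₀ hY hm h0.symm]
      · obtain ⟨W, hW, hWY⟩ := BPV.exists_variance_lt hρ hp hX₀ hY hzm hm h0
        linarith [hmin W hW]
    · have hYz := (BPV.le_beatingPerformance_iff hX₀).1 (hzX.trans hperf)
      linarith [hmin Y ⟨hY.1, hY.2, hYz⟩]
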